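/- For a complex number $x$ let $(x)_n=x(x+1)\cdots(x+n-1)$ for $n\in\mathbb{Z}^+$ and $(x)_0=1$, and for complex $k$ let $(x)_k=\Gamma(x+k)/\Gamma(x)$. Then for every $k\in\mathbb{C}\setminus\{-1,-2,-3,\dots\}$ the following series converges absolutely and $$ \sum_{n=0}^{\infty}\left(\frac{-1}{16}\right)^n \frac{\left(\frac12-k\right)_n\left(\frac12+k\right)_n\left(\frac13\right)_n\left(\frac23\right)_n} {\left(\frac12+\frac k2\right)_n\left(1+\frac k2\right)_n(1+k)_n(1)_n} \cdot\frac{(51n+7)(2n+1)+k(90n+24k+28)}{2n+k+1} =\frac{12\sqrt3}{\pi}\cdot\frac{(1)_k^2}{\left(\frac13\right)_k\left(\frac23\right)_k}, $$ where $1/(x)_k=\Gamma(x)/\Gamma(x+k)$ is understood as an entire function of $k$ (so the right-hand side is $0$ when $\frac13+k$ or $\frac23+k$ is a non-positive integer). -/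

import Mathlib

/-- The rising factorial `(x)_n = x (x + 1) ⋯ (x + n - 1)` for a natural number `n`, with
`(x)_0 = 1`, for every complex `x`. -/
noncomputable def risingFactorial (x : ℂ) (n : ℕ) : ℂ :=
  (ascPochhammer ℂ n).eval x

/-- The Pochhammer symbol `(x)_k = Γ(x + k) / Γ(x)` with complex index `k`. Mathlib's `Γ` takes the
value `0` at its poles and `a / 0 = 0`, so when `x` is not a pole of `Γ` but `x + k` is one,
`1 / pochhammer x k` is `0`, which is the value there of the entire function
`k ↦ Γ(x) / Γ(x + k)`. -/
noncomputable def pochhammer (x k : ℂ) : ℂ :=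
  Complex.Gamma (x + k) / Complex.Gamma x

open Filter Topology

/-! Write $S(k)$ for the sum. A WZ-type certificate gives
$S(k)=\frac{(1/3+k)(2/3+k)}{(1+k)^2}S(k+1)$ (`summand_sub_shift_succ`, `tsum_summand_eq_shift`).
Iterating expresses $S(k)$ as a finite product times $S(k+m)$. As $m\to\infty$, only the $n=0$ term
contributes to the leading order of $S(k+m)$, so $S(k+m)/(1+k+m)\to 24$ (`tendsto_normalized_tsum`),
while $m$ times the product tends to a Gamma quotient by Euler's limit (`gammaSeq_quotient`). Hence
$S(k)=24\,\Gamma(1+k)^2/(\Gamma(\frac13+k)\Gamma(\frac23+k))$, and reflection at $\frac13$ yields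
the stated constant. -/

theorem risingFactorial_zero (x : ℂ) : risingFactorial x 0 = 1 := by
  simp [risingFactorial]

theorem risingFactorial_succ (x : ℂ) (n : ℕ) :
    risingFactorial x (n + 1) = risingFactorial x n * (x + n) := by
  simp [risingFactorial, ascPochhammer_succ_eval]

theorem risingFactorial_succ_left (x : ℂ) (n : ℕ) :
    risingFactorial x (n + 1) = x * risingFactorial (x + 1) n := by
  induction n with
  | zero => simp [risingFactorial_succ, risingFactorial_zero]
  | succ n ih =>
    rw [risingFactorial_succ, ih, risingFactorial_succ]
    push_cast
    ring

theorem risingFactorial_eq_prod (x : ℂ) (n : ℕ) :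
    risingFactorial x n = ∏ i ∈ Finset.range n, (x + i) := by
  induction n with
  | zero => simp [risingFactorial_zero]
  | succ n ih => rw [risingFactorial_succ, ih, Finset.prod_range_succ]

theorem risingFactorial_ne_zero {x : ℂ} (hx : ∀ m : ℕ, x + m ≠ 0) (n : ℕ) :
    risingFactorial x n ≠ 0 := by
  rw [risingFactorial_eq_prod]
  exact Finset.prod_ne_zero_iff.2 fun i _ => hx i

/-- Merges the two half-step factors of the denominator, turning $-1/16$ into $-1/4$; the divisor
$2n+k+1$ then extends $(1+k)_{2n}$ to $(1+k)_{2n+1}$. -/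
theorem risingFactorial_duplication (x : ℂ) (n : ℕ) :
    4 ^ n * (risingFactorial (x / 2) n * risingFactorial (1 / 2 + x / 2) n)
      = risingFactorial x (2 * n) := by
  induction n with
  | zero => simp [risingFactorial_zero]
  | succ n ih =>
    rw [show 2 * (n + 1) = 2 * n + 1 + 1 by ring]
    simp only [risingFactorial_succ]
    rw [← ih]
    push_cast
    ring

/-! ### The summand and its telescoping under $k\mapsto k+1$ -/

/-- The hypergeometric factor of the summand, its denominator written without duplication. -/
noncomputable def hyperTerm (k : ℂ) (n : ℕ) : ℂ :=
  (-1 / 4) ^ n * (risingFactorial (1 / 2 - k) n * risingFactorial (1 / 2 + k) n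
      * risingFactorial (1 / 3) n * risingFactorial (2 / 3) n)
    / (risingFactorial (1 + k) (2 * n + 1) * risingFactorial (1 + k) n * risingFactorial 1 n)

/-- The polynomial factor of the summand. -/
noncomputable def polyFactor (k x : ℂ) : ℂ :=
  (51 * x + 7) * (2 * x + 1) + k * (90 * x + 24 * k + 28)

/-- The factor relating the sums at `k` and at `k + 1`. -/
noncomputable def shiftFactor (k : ℂ) : ℂ :=
  (1 / 3 + k) * (2 / 3 + k) / (1 + k) ^ 2

/-- The telescoping certificate. -/
noncomputable def certificate (k : ℂ) (n : ℕ) : ℂ :=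
  (-1 / 4) ^ (n + 1) * (risingFactorial (1 / 2 - k) n * risingFactorial (1 / 2 + k) (n + 1)
      * risingFactorial (1 / 3) (n + 1) * risingFactorial (2 / 3) (n + 1))
    / (risingFactorial (1 + k) (2 * n + 2) * risingFactorial (1 + k) (n + 1) * risingFactorial 1 n)
    * (24 * k - 48 * n - 32)

theorem summand_eq (k : ℂ) (n : ℕ) :
    (-1 / 16 : ℂ) ^ n
          * ((risingFactorial (1 / 2 - k) n * risingFactorial (1 / 2 + k) n
                * risingFactorial (1 / 3) n * risingFactorial (2 / 3) n)
              / (risingFactorial (1 / 2 + k / 2) n * risingFactorial (1 + k / 2) n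
                * risingFactorial (1 + k) n * risingFactorial 1 n))
          * (((51 * (n : ℂ) + 7) * (2 * (n : ℂ) + 1) + k * (90 * (n : ℂ) + 24 * k + 28))
              / (2 * (n : ℂ) + k + 1))
      = hyperTerm k n * polyFactor k n := by
  have h := risingFactorial_duplication (1 + k) n
  rw [show (1 + k) / 2 = 1 / 2 + k / 2 by ring,
    show 1 / 2 + (1 / 2 + k / 2) = 1 + k / 2 by ring] at h
  have h4 : (-1 / 16 : ℂ) ^ n = (-1 / 4) ^ n * ((4 : ℂ) ^ n)⁻¹ := by
    rw [← inv_pow, ← mul_pow]; norm_num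
  rw [hyperTerm, polyFactor, risingFactorial_succ, ← h, h4]
  push_cast
  rw [show 1 + k + 2 * (n : ℂ) = 2 * n + k + 1 by ring]
  simp only [div_eq_mul_inv, mul_inv]
  ring

variable {k : ℂ}

theorem summand_sub_shift_zero (hk : ∀ m : ℕ, 1 + k + m ≠ 0) :
    hyperTerm k 0 * polyFactor k 0 - shiftFactor k * (hyperTerm (k + 1) 0 * polyFactor (k + 1) 0)
      = certificate k 0 := by
  have h0 := hk 0
  have h1 := hk 1
  simp only [Nat.cast_zero, Nat.cast_one, add_zero] at h0 h1
  have h2 : 1 + (k + 1) ≠ 0 := by convert h1 using 1; ring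
  simp only [hyperTerm, polyFactor, shiftFactor, certificate, risingFactorial_succ,
    risingFactorial_zero, mul_zero, zero_add, Nat.cast_zero, Nat.cast_one, add_zero]
  field_simp
  ring

theorem summand_sub_shift_succ (hk : ∀ m : ℕ, 1 + k + m ≠ 0) (n : ℕ) :
    hyperTerm k (n + 1) * polyFactor k ((n + 1 : ℕ) : ℂ)
        - shiftFactor k * (hyperTerm (k + 1) (n + 1) * polyFactor (k + 1) ((n + 1 : ℕ) : ℂ))
      = certificate k (n + 1) - certificate k n := by
  have hD := risingFactorial_ne_zero hk (2 * n + 2)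
  have hE := risingFactorial_ne_zero hk (n + 1)
  have h1 : ∀ m : ℕ, (1 : ℂ) + m ≠ 0 := fun m => by
    rw [add_comm]; exact Nat.cast_add_one_ne_zero m
  have hO := risingFactorial_ne_zero h1 n
  have h0 : 1 + k ≠ 0 := by simpa using hk 0
  have ha : risingFactorial (1 / 2 - (k + 1)) (n + 1)
      = (-1 / 2 - k) * risingFactorial (1 / 2 - k) n := by
    rw [risingFactorial_succ_left]; congr 1 <;> [ring; (congr 1; ring)]
  have hb : risingFactorial (1 / 2 + k) (n + 1)
      = (1 / 2 + k) * risingFactorial (1 / 2 + (k + 1)) n := by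
    rw [risingFactorial_succ_left]; congr 2; ring
  have hs : ∀ m, risingFactorial (1 + (k + 1)) m
      = risingFactorial (1 + k) m * (1 + k + m) / (1 + k) := fun m => by
    rw [← risingFactorial_succ, risingFactorial_succ_left, add_assoc]
    field_simp
  have e2 := hk (2 * n + 2)
  have e3 := hk (2 * n + 3)
  have e4 := hk (n + 1)
  have e5 := h1 n
  simp only [hyperTerm, certificate, shiftFactor, polyFactor, ha, hs]
  rw [show 2 * (n + 1) + 1 = 2 * n + 2 + 1 by ring, show 2 * (n + 1) + 2 = 2 * n + 2 + 1 + 1 by ring]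
  rw [risingFactorial_succ (1 + k) (2 * n + 2 + 1), risingFactorial_succ (1 + k) (2 * n + 2),
    risingFactorial_succ (1 + k) (n + 1), risingFactorial_succ 1 n,
    risingFactorial_succ (1 / 2 - k) n, risingFactorial_succ (1 / 3) (n + 1),
    risingFactorial_succ (2 / 3) (n + 1), risingFactorial_succ (1 / 2 + k) (n + 1),
    risingFactorial_succ (1 / 2 + (k + 1)) n, hb,
    pow_succ (-1 / 4 : ℂ) (n + 1)]
  -- Every rising factorial is now a common one times linear factors, so with these made opaque a
  -- rational-function identity remains.
  generalize risingFactorial (1 + k) (2 * n + 2) = D at *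
  generalize risingFactorial (1 + k) (n + 1) = E at *
  generalize risingFactorial 1 n = O at *
  generalize risingFactorial (1 / 2 - k) n = A at *
  generalize risingFactorial (1 / 2 + (k + 1)) n = B at *
  generalize risingFactorial (1 / 3) (n + 1) = U at *
  generalize risingFactorial (2 / 3) (n + 1) = V at *
  generalize (-1 / 4 : ℂ) ^ (n + 1) = p at *
  push_cast at *
  generalize (n : ℂ) = x at *
  rw [show 1 + k + (2 * x + 2) = 2 * x + 3 + k by ring] at *
  rw [show 1 + k + (2 * x + 3) = 2 * x + 4 + k by ring] at *
  rw [show 1 + k + (2 * x + 2 + 1) = 2 * x + 4 + k by ring]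
  rw [show 1 + k + (x + 1) = x + 2 + k by ring] at *
  field_simp
  ring

theorem sum_range_summand_sub_shift (hk : ∀ m : ℕ, 1 + k + m ≠ 0) (n : ℕ) :
    ∑ i ∈ Finset.range (n + 1), (hyperTerm k i * polyFactor k i
        - shiftFactor k * (hyperTerm (k + 1) i * polyFactor (k + 1) i)) = certificate k n := by
  induction n with
  | zero => simpa using summand_sub_shift_zero hk
  | succ n ih => rw [Finset.sum_range_succ, ih, summand_sub_shift_succ hk]; ring

/-! ### Geometric decay in $n$ for fixed $k$ -/

theorem hyperTerm_succ (k : ℂ) (n : ℕ) :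
    hyperTerm k (n + 1) = hyperTerm k n * (-1 / 4 * ((1 / 2 - k + n) * (1 / 2 + k + n)
      * (1 / 3 + n) * (2 / 3 + n)
        / ((2 * n + 2 + k) * (2 * n + 3 + k) * (n + 1 + k) * (n + 1)))) := by
  rw [hyperTerm, hyperTerm, show 2 * (n + 1) + 1 = 2 * n + 1 + 1 + 1 by ring]
  simp only [risingFactorial_succ, pow_succ]
  push_cast
  rw [show 1 + k + (2 * (n : ℂ) + 1) = 2 * n + 2 + k by ring,
    show 1 + k + (2 * (n : ℂ) + 2) = 2 * n + 3 + k by ring,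
    show 1 + k + (n : ℂ) = n + 1 + k by ring, show 1 + (n : ℂ) = n + 1 by ring]
  simp only [div_eq_mul_inv, mul_inv]
  ring

theorem certificate_eq (k : ℂ) (n : ℕ) :
    certificate k n = hyperTerm k n * (-1 / 4 * ((1 / 2 + k + n) * (1 / 3 + n) * (2 / 3 + n)
      * (24 * k - 48 * n - 32)) / ((2 * n + 2 + k) * (n + 1 + k))) := by
  rw [hyperTerm, certificate, show 2 * n + 2 = 2 * n + 1 + 1 by ring]
  rw [risingFactorial_succ _ (2 * n + 1)]
  simp only [risingFactorial_succ _ n, pow_succ]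
  push_cast
  rw [show 1 + k + (2 * (n : ℂ) + 1) = 2 * n + 2 + k by ring,
    show 1 + k + (n : ℂ) = n + 1 + k by ring]
  simp only [div_eq_mul_inv, mul_inv]
  ring

/-- The free bounds serve two regimes: $n$ large against $\|k\|$, and $\operatorname{Re}k$ large
uniformly in $n$. -/
theorem norm_hyperTerm_succ_le {k : ℂ} {n : ℕ} {A E G : ℝ} (hE : 0 < E) (hG : 0 < G)
    (h1 : ‖1 / 2 - k + n‖ ≤ A) (h2 : ‖1 / 2 + k + n‖ ≤ A) (h3 : E ≤ ‖2 * (n : ℂ) + 2 + k‖)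
    (h4 : E ≤ ‖2 * (n : ℂ) + 3 + k‖) (h5 : G ≤ ‖(n : ℂ) + 1 + k‖) :
    ‖hyperTerm k (n + 1)‖ ≤ ‖hyperTerm k n‖ * (1 / 4 * ((A / E) ^ 2 * ((n + 1) / G))) := by
  have hA : 0 ≤ A := (norm_nonneg _).trans h1
  have h6 : ‖(1 / 3 + n : ℂ)‖ ≤ n + 1 := (norm_add_le _ _).trans (by simp; norm_num [add_comm])
  have h7 : ‖(2 / 3 + n : ℂ)‖ ≤ n + 1 := (norm_add_le _ _).trans (by simp; norm_num [add_comm])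
  have h8 : ‖(n + 1 : ℂ)‖ = n + 1 := by
    rw [← Nat.cast_add_one, Complex.norm_natCast]; simp
  have hn : (0 : ℝ) < n + 1 := by positivity
  rw [hyperTerm_succ, norm_mul]
  refine mul_le_mul_of_nonneg_left ?_ (norm_nonneg _)
  rw [norm_mul, show ‖(-1 / 4 : ℂ)‖ = 1 / 4 by norm_num, norm_div]
  simp only [norm_mul, h8]
  calc _ ≤ 1 / 4 * ((A * A * (n + 1) * (n + 1)) / (E * E * G * (n + 1))) := by gcongr
    _ = _ := by field_simp

theorem norm_hyperTerm_succ_le_half {n : ℕ} (h : 10 * ‖k‖ ≤ n) :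
    ‖hyperTerm k (n + 1)‖ ≤ ‖hyperTerm k n‖ * (1 / 2) := by
  have hn : (0 : ℝ) < n + 1 := by positivity
  have key := norm_hyperTerm_succ_le (k := k) (n := n) (A := 1.1 * (n + 1))
    (E := 1.9 * (n + 1)) (G := 0.9 * (n + 1)) (by positivity) (by positivity) ?_ ?_ ?_ ?_ ?_
  · refine key.trans (mul_le_mul_of_nonneg_left ?_ (norm_nonneg _))
    rw [mul_div_mul_right _ _ hn.ne', div_mul_cancel_right₀ hn.ne']
    norm_num
  · have := norm_sub_le (1 / 2 + n : ℂ) k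
    have h2 : ‖(1 / 2 + n : ℂ)‖ ≤ 1 / 2 + n := (norm_add_le _ _).trans (by simp)
    rw [show (1 / 2 - k + n : ℂ) = 1 / 2 + n - k by ring]
    linarith
  · have := norm_add_le (1 / 2 + n : ℂ) k
    have h2 : ‖(1 / 2 + n : ℂ)‖ ≤ 1 / 2 + n := (norm_add_le _ _).trans (by simp)
    rw [show (1 / 2 + k + n : ℂ) = 1 / 2 + n + k by ring]
    linarith
  · have := norm_sub_le (2 * (n : ℂ) + 2 + k) k
    have h2 : ‖(2 * n + 2 : ℂ)‖ = 2 * n + 2 := by exact_mod_cast Complex.norm_natCast (2 * n + 2)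
    rw [add_sub_cancel_right, h2] at this
    linarith
  · have := norm_sub_le (2 * (n : ℂ) + 3 + k) k
    have h2 : ‖(2 * n + 3 : ℂ)‖ = 2 * n + 3 := by exact_mod_cast Complex.norm_natCast (2 * n + 3)
    rw [add_sub_cancel_right, h2] at this
    linarith
  · have := norm_sub_le ((n : ℂ) + 1 + k) k
    have h2 : ‖(n + 1 : ℂ)‖ = n + 1 := by exact_mod_cast Complex.norm_natCast (n + 1)
    rw [add_sub_cancel_right, h2] at this
    linarith

theorem exists_norm_hyperTerm_le (k : ℂ) :
    ∃ C : ℝ, ∀ᶠ n : ℕ in atTop, ‖hyperTerm k n‖ ≤ C * (1 / 2) ^ n := by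
  obtain ⟨n₀, hn₀⟩ := exists_nat_ge (10 * ‖k‖)
  refine ⟨‖hyperTerm k n₀‖ * 2 ^ n₀, eventually_atTop.2 ⟨n₀, fun n hn => ?_⟩⟩
  induction n, hn using Nat.le_induction with
  | base => rw [mul_assoc, ← mul_pow]; norm_num
  | succ n hn ih =>
    have h := norm_hyperTerm_succ_le_half (hn₀.trans (Nat.cast_le.2 hn))
    rw [pow_succ]
    linarith

theorem summable_hyperTerm_mul_eval (k : ℂ) (p : Polynomial ℂ) :
    Summable fun n : ℕ => hyperTerm k n * p.eval (n : ℂ) := by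
  obtain ⟨C, hC⟩ := exists_norm_hyperTerm_le k
  induction p using Polynomial.induction_on' with
  | add p q hp hq => simpa [mul_add] using hp.add hq
  | monomial d a =>
    have hs : Summable fun n : ℕ => (n : ℝ) ^ d * (1 / 2) ^ n :=
      summable_pow_mul_geometric_of_norm_lt_one d (by norm_num)
    refine Summable.of_norm_bounded_eventually_nat (hs.mul_left (C * ‖a‖)) ?_
    filter_upwards [hC] with n hn
    rw [Polynomial.eval_monomial, norm_mul, norm_mul, norm_pow, Complex.norm_natCast]
    calc _ ≤ C * (1 / 2) ^ n * (‖a‖ * (n : ℝ) ^ d) := by gcongr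
      _ = _ := by ring

open Polynomial in
theorem summable_summand (k : ℂ) : Summable fun n : ℕ => hyperTerm k n * polyFactor k n := by
  refine (summable_hyperTerm_mul_eval k ((C 51 * X + C 7) * (C 2 * X + C 1)
    + C k * (C 90 * X + C (24 * k) + C 28))).congr fun n => ?_
  simp only [polyFactor, eval_add, eval_mul, eval_C, eval_X]

open Polynomial in
theorem tendsto_certificate (k : ℂ) : Tendsto (certificate k) atTop (𝓝 0) := by
  have h := (summable_hyperTerm_mul_eval k (C (-1 / 4) * ((C (1 / 2 + k) + X) * (C (1 / 3) + X)
    * (C (2 / 3) + X) * (C (24 * k - 32) - C 48 * X)))).tendsto_atTop_zero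
  refine squeeze_zero_norm' ?_ (by simpa only [norm_zero] using h.norm)
  obtain ⟨n₀, hn₀⟩ := exists_nat_ge ‖k‖
  filter_upwards [eventually_ge_atTop n₀] with n hn
  have hkn : ‖k‖ ≤ n := hn₀.trans (Nat.cast_le.2 hn)
  have h1 : 1 ≤ ‖2 * (n : ℂ) + 2 + k‖ := by
    have := norm_sub_le (2 * (n : ℂ) + 2 + k) k
    have h2 : ‖(2 * n + 2 : ℂ)‖ = 2 * n + 2 := by exact_mod_cast Complex.norm_natCast (2 * n + 2)
    rw [add_sub_cancel_right, h2] at this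
    linarith [(Nat.cast_nonneg n : (0 : ℝ) ≤ n)]
  have h3 : 1 ≤ ‖(n : ℂ) + 1 + k‖ := by
    have := norm_sub_le ((n : ℂ) + 1 + k) k
    have h2 : ‖(n + 1 : ℂ)‖ = n + 1 := by exact_mod_cast Complex.norm_natCast (n + 1)
    rw [add_sub_cancel_right, h2] at this
    linarith
  -- Both linear denominators have norm at least 1, so dropping them bounds the certificate by a
  -- term of a summable series.
  rw [certificate_eq, ← mul_div_assoc, norm_div]
  refine (div_le_self (norm_nonneg _) ?_).trans_eq ?_
  · rw [norm_mul]
    exact one_le_mul_of_one_le_of_one_le h1 h3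
  · simp only [eval_add, eval_sub, eval_mul, eval_C, eval_X]
    congr 1
    ring

/-! ### The recurrence for the sum and its iteration -/

theorem tsum_summand_eq_shift (hk : ∀ m : ℕ, 1 + k + m ≠ 0) :
    ∑' n : ℕ, hyperTerm k n * polyFactor k n
      = shiftFactor k * ∑' n : ℕ, hyperTerm (k + 1) n * polyFactor (k + 1) n := by
  have h := ((summable_summand k).hasSum.sub
    ((summable_summand (k + 1)).hasSum.mul_left (shiftFactor k))).tendsto_sum_nat
  have h' := (h.comp (tendsto_add_atTop_nat 1)).congr (sum_range_summand_sub_shift hk)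
  exact sub_eq_zero.1 (tendsto_nhds_unique h' (tendsto_certificate k))

theorem tsum_summand_eq_prod (hk : ∀ m : ℕ, 1 + k + m ≠ 0) (m : ℕ) :
    ∑' n : ℕ, hyperTerm k n * polyFactor k n
      = (∏ i ∈ Finset.range m, shiftFactor (k + i))
        * ∑' n : ℕ, hyperTerm (k + m) n * polyFactor (k + m) n := by
  induction m with
  | zero => simp
  | succ m ih =>
    have hm : ∀ j : ℕ, 1 + (k + m) + j ≠ 0 := fun j => by
      have := hk (m + j); push_cast at this; convert this using 1; ring
    rw [ih, Finset.prod_range_succ, tsum_summand_eq_shift hm, Nat.cast_succ]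
    simp only [add_assoc, mul_assoc]

/-! ### Asymptotics of the sum along $k+m$ -/

/-- The sequence $k+m$ eventually enters this cone, where $\|k\|\le\frac54\operatorname{Re}k$. The
factor $\frac12$ supplies domination; the other factor kills the terms with $n\ge1$ in the limit. -/
theorem norm_hyperTerm_succ_le_of_re {n : ℕ} (h : 4 * |k.im| ≤ k.re) :
    ‖hyperTerm k (n + 1)‖ ≤ ‖hyperTerm k n‖ * (1 / 2 * ((n + 1) / (n + 1 + k.re))) := by
  have hx : 0 ≤ k.re := (by positivity : 0 ≤ 4 * |k.im|).trans h
  have hn : (0 : ℝ) < n + 1 := by positivity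
  have hk := Complex.norm_le_abs_re_add_abs_im k
  rw [abs_of_nonneg hx] at hk
  have h2 : ‖(1 / 2 + n : ℂ)‖ ≤ 1 / 2 + n := (norm_add_le _ _).trans (by simp)
  have key := norm_hyperTerm_succ_le (k := k) (n := n) (A := 5 / 4 * (n + 1 + k.re))
    (E := n + 1 + k.re) (G := n + 1 + k.re) (by positivity) (by positivity) ?_ ?_ ?_ ?_ ?_
  · refine key.trans (mul_le_mul_of_nonneg_left ?_ (norm_nonneg _))
    rw [mul_div_cancel_right₀ _ (by positivity), ← mul_assoc]
    exact mul_le_mul_of_nonneg_right (by norm_num) (by positivity)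
  · have := norm_sub_le (1 / 2 + n : ℂ) k
    rw [show (1 / 2 - k + n : ℂ) = 1 / 2 + n - k by ring]
    linarith
  · have := norm_add_le (1 / 2 + n : ℂ) k
    rw [show (1 / 2 + k + n : ℂ) = 1 / 2 + n + k by ring]
    linarith
  · refine le_trans ?_ (Complex.re_le_norm _)
    simp; linarith
  · refine le_trans ?_ (Complex.re_le_norm _)
    simp; linarith
  · refine le_trans ?_ (Complex.re_le_norm _)
    simp

theorem norm_hyperTerm_le_of_re (h : 4 * |k.im| ≤ k.re) (n : ℕ) :
    ‖hyperTerm k n‖ ≤ (1 / 2) ^ n / ‖1 + k‖ := by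
  have hx : 0 ≤ k.re := (by positivity : 0 ≤ 4 * |k.im|).trans h
  induction n with
  | zero => simp [hyperTerm, risingFactorial_zero, risingFactorial_succ]
  | succ n ih =>
    refine (norm_hyperTerm_succ_le_of_re h).trans ?_
    have : (n + 1 : ℝ) / (n + 1 + k.re) ≤ 1 := div_le_one_of_le₀ (by linarith) (by positivity)
    calc _ ≤ (1 / 2) ^ n / ‖1 + k‖ * (1 / 2 * 1) := by gcongr
      _ = _ := by rw [pow_succ]; ring

theorem norm_polyFactor_le (h : 0 ≤ k.re) (n : ℕ) :
    ‖polyFactor k n‖ ≤ 400 * (n + 1) ^ 2 * ‖1 + k‖ ^ 2 := by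
  have hw : 1 ≤ ‖1 + k‖ := le_trans (by simpa using h) (Complex.re_le_norm _)
  have hz : ‖k‖ ≤ ‖1 + k‖ := by
    rw [Complex.norm_def, Complex.norm_def]
    refine Real.sqrt_le_sqrt ?_
    simp only [Complex.normSq_apply, Complex.add_re, Complex.add_im, Complex.one_re, Complex.one_im]
    nlinarith
  have hn : (0 : ℝ) ≤ n := Nat.cast_nonneg n
  set w := ‖1 + k‖
  have hw0 : 0 ≤ w := by linarith
  calc ‖polyFactor k n‖ ≤ (51 * n + 7) * (2 * n + 1) + ‖k‖ * (90 * n + 24 * ‖k‖ + 28) := by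
        rw [polyFactor]
        refine (norm_add_le _ _).trans (add_le_add ?_ ?_)
        · exact_mod_cast (Complex.norm_natCast ((51 * n + 7) * (2 * n + 1))).le
        · rw [norm_mul]
          refine mul_le_mul_of_nonneg_left ?_ (norm_nonneg _)
          refine (norm_add₃_le).trans ?_
          simp
    _ ≤ (51 * n + 7) * (2 * n + 1) + w * (90 * n + 24 * w + 28) := by gcongr
    _ ≤ 400 * (n + 1) ^ 2 * w ^ 2 := by
        have a1 : (1 : ℝ) ≤ (n + 1) ^ 2 := one_le_pow₀ (by linarith)
        have a2 : (n : ℝ) ≤ (n + 1) ^ 2 := by nlinarith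
        have a3 : (51 * n + 7) * (2 * n + 1) ≤ 102 * ((n : ℝ) + 1) ^ 2 := by nlinarith
        have b1 : 1 ≤ w ^ 2 := one_le_pow₀ hw
        have b2 : w ≤ w ^ 2 := by nlinarith
        have c1 : ((n : ℝ) + 1) ^ 2 * 1 ≤ (n + 1) ^ 2 * w ^ 2 := by gcongr
        have c2 : n * w ≤ ((n : ℝ) + 1) ^ 2 * w ^ 2 := by gcongr
        have c3 : 1 * w ^ 2 ≤ ((n : ℝ) + 1) ^ 2 * w ^ 2 := by gcongr
        linarith

theorem tendsto_re_add_nat_atTop (k : ℂ) : Tendsto (fun m : ℕ => (k + m).re) atTop atTop := by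
  simpa using tendsto_atTop_add_const_left atTop k.re tendsto_natCast_atTop_atTop

theorem tendsto_inv_add_nat (k : ℂ) : Tendsto (fun m : ℕ => (k + m)⁻¹) atTop (𝓝 0) := by
  refine tendsto_inv₀_cobounded.comp (tendsto_norm_atTop_iff_cobounded.1 ?_)
  exact tendsto_atTop_mono (fun m => Complex.re_le_norm _) (tendsto_re_add_nat_atTop k)

theorem tendsto_normalized_summand (k : ℂ) (n : ℕ) :
    Tendsto (fun m : ℕ => hyperTerm (k + m) n * polyFactor (k + m) n / (1 + (k + m))) atTop
      (𝓝 (if n = 0 then 24 else 0)) := by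
  have hre := tendsto_re_add_nat_atTop k
  cases n with
  | zero =>
    rw [if_pos rfl]
    have hinv := tendsto_inv_add_nat (1 + k)
    -- With $z=1+k+m$, the normalized zeroth term is $(24z^2-20z+3)/z^2$.
    have h : Tendsto (fun m : ℕ => 24 - 20 * (1 + k + m)⁻¹ + 3 * (1 + k + m)⁻¹ ^ 2) atTop
        (𝓝 (24 - 20 * 0 + 3 * 0 ^ 2)) :=
      (tendsto_const_nhds.sub (hinv.const_mul _)).add ((hinv.pow 2).const_mul _)
    norm_num only at h
    refine h.congr' ?_
    filter_upwards [hre.eventually_ge_atTop 0] with m hm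
    have h0 : 1 + k + m ≠ 0 := fun h0 => by
      have := congrArg Complex.re h0
      simp at this hm
      linarith
    simp only [hyperTerm, polyFactor, risingFactorial_zero, risingFactorial_succ, mul_zero,
      zero_add, Nat.cast_zero, add_zero, ← add_assoc]
    field_simp
    ring
  | succ n =>
    rw [if_neg n.succ_ne_zero]
    have hlim : Tendsto (fun m : ℕ => (1 / 2) ^ n * (1 / 2 * (n + 1)) *
        (400 * (((n + 1 : ℕ) : ℝ) + 1) ^ 2) * ((n + 1 + (k + m).re)⁻¹)) atTop (𝓝 0) := by
      simpa only [mul_zero, Function.comp_apply] using (tendsto_inv_atTop_zero.comp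
        (tendsto_atTop_add_const_left atTop _ hre)).const_mul
          ((1 / 2) ^ n * (1 / 2 * ((n : ℝ) + 1)) * (400 * (((n + 1 : ℕ) : ℝ) + 1) ^ 2))
    refine squeeze_zero_norm' ?_ hlim
    filter_upwards [hre.eventually_ge_atTop (4 * |k.im|)] with m hm
    have hm' : 4 * |(k + m).im| ≤ (k + m).re := by simpa using hm
    have hx : 0 ≤ (k + m).re := (by positivity : 0 ≤ 4 * |k.im|).trans hm
    have hw : 0 < ‖1 + (k + m)‖ := by
      refine lt_of_lt_of_le ?_ (Complex.re_le_norm _)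
      rw [Complex.add_re, Complex.one_re]; linarith
    rw [norm_div, norm_mul, div_le_iff₀ hw]
    calc _ ≤ (1 / 2) ^ n / ‖1 + (k + m)‖ * (1 / 2 * ((n + 1) / (n + 1 + (k + m).re)))
          * (400 * (((n + 1 : ℕ) : ℝ) + 1) ^ 2 * ‖1 + (k + m)‖ ^ 2) := by
          gcongr
          · refine (norm_hyperTerm_succ_le_of_re hm').trans ?_
            gcongr
            exact norm_hyperTerm_le_of_re hm' n
          · exact norm_polyFactor_le hx (n + 1)
      _ = _ := by field_simp

theorem norm_normalized_summand_le (h : 4 * |k.im| ≤ k.re) (n : ℕ) :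
    ‖hyperTerm k n * polyFactor k n / (1 + k)‖ ≤ 400 * ((n + 1) ^ 2 * (1 / 2) ^ n) := by
  have hx : 0 ≤ k.re := (by positivity : 0 ≤ 4 * |k.im|).trans h
  have hw : 0 < ‖1 + k‖ := by
    refine lt_of_lt_of_le ?_ (Complex.re_le_norm _)
    rw [Complex.add_re, Complex.one_re]; linarith
  rw [norm_div, norm_mul, div_le_iff₀ hw]
  calc _ ≤ (1 / 2) ^ n / ‖1 + k‖ * (400 * (n + 1) ^ 2 * ‖1 + k‖ ^ 2) :=
        mul_le_mul (norm_hyperTerm_le_of_re h n) (norm_polyFactor_le hx n) (norm_nonneg _)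
          (by positivity)
    _ = _ := by field_simp

theorem tendsto_normalized_tsum (k : ℂ) :
    Tendsto (fun m : ℕ => (∑' n : ℕ, hyperTerm (k + m) n * polyFactor (k + m) n)
      / (1 + (k + m))) atTop (𝓝 24) := by
  have hb : Summable fun n : ℕ => 400 * (((n : ℝ) + 1) ^ 2 * (1 / 2) ^ n) := by
    have h := (summable_nat_add_iff 1).2
      (summable_pow_mul_geometric_of_norm_lt_one (R := ℝ) 2 (r := 1 / 2) (by norm_num))
    refine (h.mul_left 800).congr fun n => ?_
    push_cast
    ring
  have h := tendsto_tsum_of_dominated_convergence hb (tendsto_normalized_summand k) ?_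
  · rw [tsum_ite_eq] at h
    exact h.congr fun m => tsum_div_const
  · filter_upwards [(tendsto_re_add_nat_atTop k).eventually_ge_atTop (4 * |k.im|)] with m hm n
    exact norm_normalized_summand_le (by simpa using hm) n

/-! ### Euler's limit and the Gamma quotient -/

theorem prod_shiftFactor (k : ℂ) (m : ℕ) :
    ∏ i ∈ Finset.range m, shiftFactor (k + i)
      = risingFactorial (1 / 3 + k) m * risingFactorial (2 / 3 + k) m
        / risingFactorial (1 + k) m ^ 2 := by
  simp only [risingFactorial_eq_prod, shiftFactor, ← Finset.prod_pow, ← Finset.prod_mul_distrib,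
    ← Finset.prod_div_distrib, add_assoc]

/-- The factor $m$ is left over from the powers, since $2(1+k)-(\frac13+k)-(\frac23+k)=1$; the
factorials cancel. -/
theorem gammaSeq_quotient (k : ℂ) {m : ℕ} (hm : m ≠ 0) :
    Complex.GammaSeq (1 + k) m ^ 2
        / (Complex.GammaSeq (1 / 3 + k) m * Complex.GammaSeq (2 / 3 + k) m)
      = m * ∏ i ∈ Finset.range (m + 1), shiftFactor (k + i) := by
  have hm0 : (m : ℂ) ≠ 0 := Nat.cast_ne_zero.2 hm
  have hf : (m.factorial : ℂ) ≠ 0 := Nat.cast_ne_zero.2 m.factorial_ne_zero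
  have hp : ((m : ℂ) ^ (1 + k)) ^ 2 = m * ((m : ℂ) ^ (1 / 3 + k) * (m : ℂ) ^ (2 / 3 + k)) := by
    rw [← Complex.cpow_add _ _ hm0, sq, ← Complex.cpow_add _ _ hm0]
    nth_rewrite 2 [← Complex.cpow_one (m : ℂ)]
    rw [← Complex.cpow_add _ _ hm0]
    congr 1
    ring
  have h1 : (m : ℂ) ^ (1 / 3 + k) ≠ 0 := by simp [Complex.cpow_eq_zero_iff, hm]
  have h2 : (m : ℂ) ^ (2 / 3 + k) ≠ 0 := by simp [Complex.cpow_eq_zero_iff, hm]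
  simp only [prod_shiftFactor, Complex.GammaSeq, ← risingFactorial_eq_prod]
  rw [div_pow, mul_pow, hp]
  generalize risingFactorial (1 + k) (m + 1) = a
  generalize risingFactorial (1 / 3 + k) (m + 1) = b
  generalize risingFactorial (2 / 3 + k) (m + 1) = c
  rw [div_mul_div_comm, div_div_div_eq]
  rw [show (m : ℂ) * ((m : ℂ) ^ (1 / 3 + k) * (m : ℂ) ^ (2 / 3 + k)) * (m.factorial : ℂ) ^ 2
      * (b * c) = (m * (b * c)) * ((m : ℂ) ^ (1 / 3 + k) * m.factorial
        * ((m : ℂ) ^ (2 / 3 + k) * m.factorial)) by ring,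
    mul_div_mul_right _ _ (mul_ne_zero (mul_ne_zero h1 hf) (mul_ne_zero h2 hf)), mul_div_assoc]

theorem tsum_summand_eq_of_forall_ne (hk : ∀ m : ℕ, 1 + k + m ≠ 0)
    (h1 : ∀ m : ℕ, 1 / 3 + k ≠ -m) (h2 : ∀ m : ℕ, 2 / 3 + k ≠ -m) :
    ∑' n : ℕ, hyperTerm k n * polyFactor k n
      = 24 * (Complex.Gamma (1 + k) ^ 2
        / (Complex.Gamma (1 / 3 + k) * Complex.Gamma (2 / 3 + k))) := by
  have hG := ((Complex.GammaSeq_tendsto_Gamma (1 + k)).pow 2).div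
    ((Complex.GammaSeq_tendsto_Gamma (1 / 3 + k)).mul (Complex.GammaSeq_tendsto_Gamma (2 / 3 + k)))
    (mul_ne_zero (Complex.Gamma_ne_zero h1) (Complex.Gamma_ne_zero h2))
  have hS := (tendsto_normalized_tsum k).comp (tendsto_add_atTop_nat 1)
  -- This is $(k+m+2)/m$, reconciling the factor $m$ with the normalization of $S(k+m+1)$; the
  -- triple product then equals $S(k)$ for every $m\ne0$.
  have hq : Tendsto (fun m : ℕ => (k + 2) * (0 + (m : ℂ))⁻¹ + 1) atTop
      (𝓝 ((k + 2) * 0 + 1)) := ((tendsto_inv_add_nat 0).const_mul _).add_const 1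
  have hall := (hG.mul hS).mul hq
  rw [mul_zero, zero_add, mul_one, mul_comm _ (24 : ℂ)] at hall
  refine tendsto_nhds_unique (tendsto_const_nhds.congr' ?_) hall
  filter_upwards [eventually_ne_atTop 0] with m hm
  have hm0 : (m : ℂ) ≠ 0 := Nat.cast_ne_zero.2 hm
  have hz : 1 + (k + ((m + 1 : ℕ) : ℂ)) ≠ 0 := by
    rw [← add_assoc]; exact hk (m + 1)
  simp only [Function.comp_apply, Pi.div_apply]
  rw [gammaSeq_quotient k hm, tsum_summand_eq_prod hk (m + 1)]
  generalize (∑' n : ℕ, hyperTerm (k + ((m + 1 : ℕ) : ℂ)) n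
    * polyFactor (k + ((m + 1 : ℕ) : ℂ)) n) = S
  push_cast at *
  rw [show (k + 2) * (0 + (m : ℂ))⁻¹ + 1 = (1 + (k + (m + 1))) / m by
    rw [zero_add]; field_simp; ring]
  field_simp

/-- Covers the poles of the denominator Gammas, where the limit of quotients is unavailable: one
factor of the iterated product vanishes. -/
theorem tsum_summand_eq_zero (hk : ∀ m : ℕ, 1 + k + m ≠ 0)
    {m : ℕ} (h : (1 / 3 + k + m) * (2 / 3 + k + m) = 0) :
    ∑' n : ℕ, hyperTerm k n * polyFactor k n = 0 := by
  rw [tsum_summand_eq_prod hk (m + 1), Finset.prod_range_succ,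
    show shiftFactor (k + m) = 0 by rw [shiftFactor, ← add_assoc, ← add_assoc, h, zero_div],
    mul_zero, zero_mul]

theorem tsum_summand_eq (hk : ∀ m : ℕ, 1 + k + m ≠ 0) :
    ∑' n : ℕ, hyperTerm k n * polyFactor k n
      = 24 * (Complex.Gamma (1 + k) ^ 2
        / (Complex.Gamma (1 / 3 + k) * Complex.Gamma (2 / 3 + k))) := by
  by_cases h1 : ∃ m : ℕ, 1 / 3 + k = -m
  · obtain ⟨m, hm⟩ := h1
    -- The right side is also 0, because `Complex.Gamma` is 0 at its poles and division by 0 gives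
    -- 0.
    rw [tsum_summand_eq_zero hk (m := m) (by rw [hm]; ring), hm, Complex.Gamma_neg_nat_eq_zero]
    simp
  by_cases h2 : ∃ m : ℕ, 2 / 3 + k = -m
  · obtain ⟨m, hm⟩ := h2
    rw [tsum_summand_eq_zero hk (m := m) (by rw [hm]; ring), hm, Complex.Gamma_neg_nat_eq_zero]
    simp
  push Not at h1 h2
  exact tsum_summand_eq_of_forall_ne hk h1 h2

/-! ### The constant, and the theorem -/

theorem Gamma_one_third_mul_Gamma_two_thirds :
    Complex.Gamma (1 / 3) * Complex.Gamma (2 / 3) = 2 * Real.pi / (Real.sqrt 3 : ℂ) := by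
  have h := Complex.Gamma_mul_Gamma_one_sub (1 / 3)
  have hs : Complex.sin (Real.pi * (1 / 3)) = (Real.sqrt 3 : ℂ) / 2 := by
    have := congrArg (fun x : ℝ => (x : ℂ)) Real.sin_pi_div_three
    push_cast at this
    rw [← this]; congr 1; ring
  rw [show (1 - 1 / 3 : ℂ) = 2 / 3 by norm_num, hs] at h
  rw [h, div_div_eq_mul_div, mul_comm]

theorem mainTheorem2 (k : ℂ) (hk : ∀ m : ℕ, k ≠ -((m : ℂ) + 1)) :
    HasSum
      (fun n : ℕ =>
        (-1 / 16 : ℂ) ^ n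
          * ((risingFactorial (1 / 2 - k) n * risingFactorial (1 / 2 + k) n
                * risingFactorial (1 / 3) n * risingFactorial (2 / 3) n)
              / (risingFactorial (1 / 2 + k / 2) n * risingFactorial (1 + k / 2) n
                * risingFactorial (1 + k) n * risingFactorial 1 n))
          * (((51 * (n : ℂ) + 7) * (2 * (n : ℂ) + 1) + k * (90 * (n : ℂ) + 24 * k + 28))
              / (2 * (n : ℂ) + k + 1)))
      (12 * (Real.sqrt 3 : ℂ) / (Real.pi : ℂ)
        * (pochhammer 1 k ^ 2 / (pochhammer (1 / 3) k * pochhammer (2 / 3) k))) := by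
  have hk' : ∀ m : ℕ, 1 + k + m ≠ 0 := fun m h => hk m (by linear_combination h)
  simp only [summand_eq]
  have h3 : (Real.sqrt 3 : ℂ) ≠ 0 := by
    exact_mod_cast (Real.sqrt_pos.2 (by norm_num : (0 : ℝ) < 3)).ne'
  have hpi : (Real.pi : ℂ) ≠ 0 := by exact_mod_cast Real.pi_ne_zero
  convert (summable_summand k).hasSum using 1
  rw [tsum_summand_eq hk']
  simp only [pochhammer, Complex.Gamma_one, div_one]
  rw [div_mul_div_comm (Complex.Gamma (1 / 3 + k)), Gamma_one_third_mul_Gamma_two_thirds]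
  generalize Complex.Gamma (1 / 3 + k) * Complex.Gamma (2 / 3 + k) = g
  rw [div_div_eq_mul_div]
  field_simp
  ring
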